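/- \textbf{Definitions.} A simplicial graph is regarded as a length space in which every edge is isometric to $[0,1]$. A \emph{cycle} in a graph $\Gamma$ is a nondegenerate combinatorial map $f\colon C\to\Gamma$ from a (based, oriented) circle graph $C$ (equivalently, a closed edge path of positive length); its length $|C|$ is the number of edges of $C$. It is \emph{isometric} if it is an isometric embedding, and \emph{$\xi$-almost isometric} if $d_\Gamma(f(p),f(q))\ge \xi\,|C|/2$ for every pair of antipodal points $p,q\in C$. A connected (nonempty) simplicial graph $\Gamma$ is \emph{shortcut} if there is a bound on the lengths of its isometric cycles, and \emph{strongly shortcut} if, for some $\xi\in(0,1)$, there is a bound on the lengths of its $\xi$-almost isometric cycles. A group is \emph{(strongly) shortcut} if it acts properly and cocompactly by graph automorphisms on a (strongly) shortcut graph. For $\theta\in\mathbb N$ the \emph{filling} $F_\theta(\Gamma)$ is the $2$-complex with $1$-skeleton $\Gamma$ and one $2$-cell with attaching map $f$ for each cycle $f$ in $\Gamma$ of length at most $\theta$. The \emph{area} of a closed edge path in a $2$-complex is the least number of $2$-cells across which it must be pushed in a combinatorial null-homotopy ($\infty$ if it is not null-homotopic). The \emph{Dehn function} $\Delta(n)$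 of the $2$-complex is the supremum of the areas of the closed edge paths of length at most $n$. The Dehn function of a finite presentation $\langle S\mid R\rangle$ of a group is the supremum, over the words $w$ of length at most $n$ that represent the identity, of the least number of factors in an expression of $w$ in the free group on $S$ as a product of conjugates of elements of $R^{\pm1}$. \textbf{Theorem.} \begin{enumerate} \item Let $\Gamma$ be a shortcut graph. Then there is $\theta_0$ such that for all $\theta\ge\theta_0$ the Dehn function $\Delta$ of $F_\theta(\Gamma)$ satisfies $\Delta(n)\le 2^n$ for all $n\in\mathbb N$. \item Let $\Gamma$ be a strongly shortcut graph. Then there are $b>1$ and $\theta_0$ such that for all $\theta\ge\theta_0$ the Dehn function $\Delta$ of $F_\theta(\Gamma)$ satisfies $\Delta(n)\le n^{\log_b 2}$ for all $n\in\mathbb N$. \item Let $G$ be a shortcut group. Then $G$ is finitely presented and has an exponential isoperimetric function: for every finite presentation of $G$ there is $C\in\mathbb N$ such that its Dehn function is at most $C\,2^{Cn}$ for all $n$. \item Let $G$ be a strongly shortcut group. Then $G$ is finitely presented and has a polynomial isoperimetric function: the Dehn function of every finite presentation of $G$ is bounded above by a polynomial in $n$. \item Let $G$ be a shortcut group. Then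 $G$ has a decidable word problem: $G$ is finitely generated and, for every finite generating family of $G$, there is an algorithm that decides which words in the generators and their inverses represent the identity. \end{enumerate} -/

import Mathlib

open scoped ENNReal

universe u v

noncomputable section

namespace ShortcutGraph


/-! ### Simplicial graphs as geodesic spaces

The geometric realization of a simple graph `Γ` is the length space in which every edge is isometric
to `[0, 1]`.  A point of it that lies on an edge is written `((x, y), t)` with `Γ.Adj x y` and
`0 ≤ t ≤ 1`: it is the point of the edge `xy` at distance `t` from `x`. -/

open Classical in
/-- The geodesic distance between two points of the geometric realization of a connected graph:
along the edge if the two points are on the same edge, and otherwise the least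
length of a path that leaves the first edge through one of its ends and enters the second edge
through one of its ends. -/
def pointDist {V : Type u} (Γ : SimpleGraph V) (p q : (V × V) × ℝ) : ℝ :=
  if q.1 = p.1 then |p.2 - q.2|
  else if q.1 = p.1.swap then |p.2 - (1 - q.2)|
  else
    min
      (min (p.2 + Γ.dist p.1.1 q.1.1 + q.2) (p.2 + Γ.dist p.1.1 q.1.2 + (1 - q.2)))
      (min ((1 - p.2) + Γ.dist p.1.2 q.1.1 + q.2)
        ((1 - p.2) + Γ.dist p.1.2 q.1.2 + (1 - q.2)))

/-- A (based, oriented) cycle `f : C → Γ` of length `n > 0` is a closed walk with `n` edges.  Its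
domain `C` is the circle `ℝ / nℤ`; this is the image under `f` of the class of `a : ℝ`. -/
def cyclePoint {V : Type u} {Γ : SimpleGraph V} {x : V} (w : Γ.Walk x x) (a : ℝ) :
    (V × V) × ℝ :=
  let i : ℕ := (⌊a⌋ % (w.length : ℤ)).toNat
  ((w.getVert i, w.getVert (i + 1)), Int.fract a)

/-- A cycle is isometric if it is an isometric embedding of the circle of length `n`. -/
def IsIsometricCycle {V : Type u} {Γ : SimpleGraph V} {x : V} (w : Γ.Walk x x) : Prop :=
  0 < w.length ∧ ∀ a b : ℝ,
    pointDist Γ (cyclePoint w a) (cyclePoint w b) =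
      dist (a : AddCircle (w.length : ℝ)) (b : AddCircle (w.length : ℝ))

/-- A cycle `f : C → Γ` is `ξ`-almost isometric if `d(f p, f q) ≥ ξ |C| / 2` for all antipodal
points `p`, `q` of `C`. -/
def IsAlmostIsometricCycle {V : Type u} {Γ : SimpleGraph V} (ξ : ℝ) {x : V} (w : Γ.Walk x x) :
    Prop :=
  0 < w.length ∧ ∀ a : ℝ,
    ξ * ((w.length : ℝ) / 2) ≤
      pointDist Γ (cyclePoint w a) (cyclePoint w (a + (w.length : ℝ) / 2))

/-- Shortcut graphs: connected, with a bound on the lengths of the isometric cycles. -/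
def IsShortcut {V : Type u} (Γ : SimpleGraph V) : Prop :=
  Γ.Connected ∧ ∃ θ : ℕ, ∀ (x : V) (w : Γ.Walk x x), IsIsometricCycle w → w.length ≤ θ

/-- Strongly shortcut graphs: connected, with a bound on the lengths of the `ξ`-almost isometric
cycles, for some `ξ ∈ (0, 1)`. -/
def IsStronglyShortcut {V : Type u} (Γ : SimpleGraph V) : Prop :=
  Γ.Connected ∧ ∃ (θ : ℕ) (ξ : ℝ), 0 < ξ ∧ ξ < 1 ∧
    ∀ (x : V) (w : Γ.Walk x x), IsAlmostIsometricCycle ξ w → w.length ≤ θ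

/-! ### Two-complexes, fillings and Dehn functions -/

/-- A combinatorial `2`-complex with simplicial `1`-skeleton `graph`; every `2`-cell is attached
along a cycle of the `1`-skeleton. -/
structure TwoComplex (V : Type u) where
  graph : SimpleGraph V
  Cell : Type u
  boundary : Cell → Σ x : V, graph.Walk x x
  boundary_pos : ∀ e, 0 < (boundary e).2.length

/-- The `θ`-filling of `Γ`: the `2`-complex with `1`-skeleton `Γ` and exactly one `2`-cell for each
(based, oriented) cycle of `Γ` of length at most `θ`, attached along that cycle. -/
def filling {V : Type u} (Γ : SimpleGraph V) (θ : ℕ) : TwoComplex V where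
  graph := Γ
  Cell := {c : Σ x : V, Γ.Walk x x // 0 < c.2.length ∧ c.2.length ≤ θ}
  boundary c := c.1
  boundary_pos c := c.2.1

namespace TwoComplex

variable {V : Type u} (X : TwoComplex V)

/-- The closed walk `w` goes once around a `2`-cell of `X`, starting at any point of the boundary of
the cell and in either direction. -/
def BoundsCell {y : V} (w : X.graph.Walk y y) : Prop :=
  ∃ (e : X.Cell) (x : V) (p : X.graph.Walk x y) (q : X.graph.Walk y x),
    X.boundary e = ⟨x, p.append q⟩ ∧ (w = q.append p ∨ w = (q.append p).reverse)

/-- `w'` is obtained from `w` by inserting a backtrack `a → b → a`. -/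
def Backtrack {x y : V} (w w' : X.graph.Walk x y) : Prop :=
  ∃ (a b : V) (h : X.graph.Adj a b) (s : X.graph.Walk x a) (t : X.graph.Walk a y),
    w = s.append t ∧ w' = s.append (.cons h (.cons h.symm t))

/-- `w'` is obtained from `w` by pushing it across one `2`-cell: a subpath `p` of `w` is replaced by
a path `q` such that `p` followed by the reverse of `q` goes once around a `2`-cell. -/
def CellMove {x y : V} (w w' : X.graph.Walk x y) : Prop :=
  ∃ (a b : V) (s : X.graph.Walk x a) (p q : X.graph.Walk a b) (t : X.graph.Walk b y),
    X.BoundsCell (p.append q.reverse) ∧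
      w = s.append (p.append t) ∧ w' = s.append (q.append t)

/-- `X.Homotopy N w w'`: there is a combinatorial homotopy, relative to the end points, from `w` to
`w'` that pushes across a `2`-cell exactly `N` times. -/
inductive Homotopy {x y : V} : ℕ → X.graph.Walk x y → X.graph.Walk x y → Prop
  | refl (w : X.graph.Walk x y) : Homotopy 0 w w
  | insert {N : ℕ} {w w' w'' : X.graph.Walk x y} :
      Homotopy N w w' → X.Backtrack w' w'' → Homotopy N w w''
  | delete {N : ℕ} {w w' w'' : X.graph.Walk x y} :
      Homotopy N w w' → X.Backtrack w'' w' → Homotopy N w w''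
  | push {N : ℕ} {w w' w'' : X.graph.Walk x y} :
      Homotopy N w w' → X.CellMove w' w'' → Homotopy (N + 1) w w''

/-- The area of a closed edge path: the least number of `2`-cells in a combinatorial null-homotopy,
and `⊤` if the path is not null-homotopic. -/
def area {x : V} (w : X.graph.Walk x x) : ℕ∞ :=
  ⨅ (N : ℕ) (_ : X.Homotopy N w .nil), (N : ℕ∞)

/-- The Dehn function of `X`: the supremum of the areas of the closed edge paths of length at
most `n`.  It is `⊤` where one of these paths is not null-homotopic, or the areas are unbounded. -/
def dehn (n : ℕ) : ℕ∞ :=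
  ⨆ (x : V) (w : X.graph.Walk x x) (_ : w.length ≤ n), X.area w

end TwoComplex

/-! ### Groups -/

/-- An action of `G` on the graph `Γ` (by graph automorphisms) that is proper and cocompact.

A compact subset of `Γ` lies in a finite subgraph, so the action is proper
if and only if a finite set of vertices meets only finitely many of its translates, and
it is cocompact if and only if the translates of a finite set of vertices contain all vertices and
both ends of every edge at once. -/
structure IsProperCocompactAction (G : Type u) [Group G] {V : Type v} [MulAction G V]
    (Γ : SimpleGraph V) : Prop where
  adj_smul : ∀ (g : G) (x y : V), Γ.Adj x y → Γ.Adj (g • x) (g • y)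
  proper : ∀ K : Set V, K.Finite → {g : G | ∃ x ∈ K, g • x ∈ K}.Finite
  cocompact : ∃ K : Set V, K.Finite ∧ (∀ x, ∃ g : G, g • x ∈ K) ∧
    ∀ x y, Γ.Adj x y → ∃ g : G, g • x ∈ K ∧ g • y ∈ K

/-- Shortcut groups. -/
def IsShortcutGroup (G : Type u) [Group G] : Prop :=
  ∃ (V : Type v) (Γ : SimpleGraph V) (_ : MulAction G V),
    IsShortcut Γ ∧ IsProperCocompactAction G Γ

/-- Strongly shortcut groups. -/
def IsStronglyShortcutGroup (G : Type u) [Group G] : Prop :=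
  ∃ (V : Type v) (Γ : SimpleGraph V) (_ : MulAction G V),
    IsStronglyShortcut Γ ∧ IsProperCocompactAction G Γ

/-- The area of an element of a free group with respect to a set `R` of relators: the least number of
factors in an expression of it as a product of conjugates of elements of `R` and their inverses,
and `⊤` if there is none. -/
def relatorArea {α : Type} (R : Set (FreeGroup α)) (w : FreeGroup α) : ℕ∞ :=
  ⨅ (l : List (FreeGroup α × FreeGroup α)) (_ : ∀ c ∈ l, c.2 ∈ R ∨ c.2⁻¹ ∈ R)
    (_ : (l.map fun c => c.1 * c.2 * c.1⁻¹).prod = w), (l.length : ℕ∞)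

/-- The Dehn function of the presentation `⟨α | R⟩`: the supremum of the areas of the words of length
at most `n` that represent the identity. -/
def relatorDehn {α : Type} (R : Set (FreeGroup α)) (n : ℕ) : ℕ∞ :=
  ⨆ (w : List (α × Bool)) (_ : w.length ≤ n)
    (_ : FreeGroup.mk w ∈ Subgroup.normalClosure R), relatorArea R (FreeGroup.mk w)

/-- `G` is finitely presented, and the Dehn function of each of its finite presentations is bounded
above by a function that satisfies `P`. -/
def HasIsoperimetricFunction (G : Type u) [Group G] (P : (ℕ → ℕ) → Prop) : Prop :=
  Group.IsFinitelyPresented G ∧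
    ∀ (k : ℕ) (φ : FreeGroup (Fin k) →* G) (R : Set (FreeGroup (Fin k))),
      Function.Surjective φ → R.Finite → Subgroup.normalClosure R = φ.ker →
        ∃ f : ℕ → ℕ, P f ∧ ∀ n : ℕ, relatorDehn R n ≤ (f n : ℕ∞)

/-- `f` is an exponential function, `f n = C * 2 ^ (C * n)`. -/
def IsExponential (f : ℕ → ℕ) : Prop := ∃ C : ℕ, ∀ n, f n = C * 2 ^ (C * n)

/-- `f` is a polynomial function. -/
def IsPolynomial (f : ℕ → ℕ) : Prop := ∃ p : Polynomial ℕ, ∀ n, f n = p.eval n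

/-- `G` is finitely generated and, for each finite generating family, there is an algorithm that
decides which words in the generators and their inverses represent the identity. -/
def HasDecidableWordProblem (G : Type u) [Group G] : Prop :=
  Group.FG G ∧ ∀ (k : ℕ) (s : Fin k → G), Subgroup.closure (Set.range s) = ⊤ →
    ComputablePred fun w : List (Fin k × Bool) => FreeGroup.lift s (FreeGroup.mk w) = 1

end ShortcutGraph

end

/-! A closed walk of length n that is not isometric has two vertices closer together in Γ than along
either arc. Cutting along a geodesic between them leaves two strictly shorter closed walks, so the
number of pieces satisfies A(n) ≤ 2A(n - 1). In the strongly shortcut case the chord joins nearly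
antipodal vertices and both pieces have length at most n/b, so A(n) ≤ 2A(n/b), which n^(log_b 2)
solves. `exists_fills` runs both recursions; `Fills.homotopy` turns a cut pattern into a
null-homotopy.

For a group, `exists_labelling` gives a coarse inverse of the orbit map, so that edges of Γ acquire
words from a finite set. A relation of length n is followed along an orbit by a closed walk of
length at most d * n, and the cuts of that walk become replacements of subwords (`Fills.derives`,
`exists_derives`). Counting pieces bounds the area over any finite presentation. The nesting depth
is bounded by a computable function of n, so listing all words derivable to that depth solves the
word problem. -/

namespace ShortcutGraph

/-! ### Cutting closed walks into short pieces -/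

variable {V : Type u} {Γ : SimpleGraph V}

/-- `Fills Γ θ N m x w`: the closed walk `w` can be cut along chords, with at most `m` nested cuts,
into `N` closed walks of length at most `θ`. -/
inductive Fills (Γ : SimpleGraph V) (θ : ℕ) : ℕ → ℕ → ∀ x : V, Γ.Walk x x → Prop
  | base {x : V} (m : ℕ) (w : Γ.Walk x x) : w.length ≤ θ → Fills Γ θ 1 m x w
  | split {N₁ N₂ m : ℕ} {x a b : V} (s : Γ.Walk x a) (p q : Γ.Walk a b) (t : Γ.Walk b x) :
      Fills Γ θ N₁ m x (s.append (q.append t)) → Fills Γ θ N₂ m a (p.append q.reverse) →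
      Fills Γ θ (N₁ + N₂) (m + 1) x (s.append (p.append t))

theorem Fills.mono {θ N m x} {w : Γ.Walk x x} (h : Fills Γ θ N m x w) {m' : ℕ} (hm : m ≤ m') :
    Fills Γ θ N m' x w := by
  induction h generalizing m' with
  | base m w hw => exact .base _ _ hw
  | split s p q t _ _ ih₁ ih₂ =>
    obtain ⟨k, rfl⟩ : ∃ k, m' = k + 1 := ⟨m' - 1, by omega⟩
    exact .split s p q t (ih₁ (by omega)) (ih₂ (by omega))

/-- If every long closed walk can be cut into two shorter ones with control of a weight `F`, then
the number of pieces is bounded by the weight. -/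
theorem exists_fills {θ : ℕ} (F : ℕ → ℝ) (hF : ∀ n, 1 ≤ F n)
    (hsplit : ∀ (x : V) (w : Γ.Walk x x), θ < w.length →
      ∃ (a b : V) (s : Γ.Walk x a) (p q : Γ.Walk a b) (t : Γ.Walk b x),
        w = s.append (p.append t) ∧ (s.append (q.append t)).length < w.length ∧
        (p.append q.reverse).length < w.length ∧
        F (s.append (q.append t)).length + F (p.append q.reverse).length ≤ F w.length)
    (n : ℕ) : ∀ (x : V) (w : Γ.Walk x x), w.length ≤ n →
      ∃ N : ℕ, (N : ℝ) ≤ F w.length ∧ Fills Γ θ N n x w := by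
  induction n with
  | zero => exact fun x w hw => ⟨1, by simpa using hF _, .base _ _ (by omega)⟩
  | succ n ih =>
    intro x w hw
    by_cases hθ : w.length ≤ θ
    · exact ⟨1, by simpa using hF _, .base _ _ hθ⟩
    · obtain ⟨a, b, s, p, q, t, rfl, h₁, h₂, h⟩ := hsplit x w (by omega)
      obtain ⟨N₁, hN₁, H₁⟩ := ih _ _ (Nat.le_of_lt_succ (h₁.trans_le hw))
      obtain ⟨N₂, hN₂, H₂⟩ := ih _ _ (Nat.le_of_lt_succ (h₂.trans_le hw))
      exact ⟨N₁ + N₂, by push_cast; linarith, .split s p q t H₁ H₂⟩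

/-! ### Fillings and null-homotopies -/

namespace TwoComplex

variable {X : TwoComplex V}

theorem Homotopy.trans {x y : V} {N M : ℕ} {w₁ w₂ w₃ : X.graph.Walk x y}
    (h₁ : X.Homotopy N w₁ w₂) (h₂ : X.Homotopy M w₂ w₃) : X.Homotopy (N + M) w₁ w₃ := by
  induction h₂ with
  | refl => exact h₁
  | insert _ h ih => exact (ih h₁).insert h
  | delete _ h ih => exact (ih h₁).delete h
  | push _ h ih => exact (ih h₁).push h

theorem Backtrack.context {x a b y : V} (s : X.graph.Walk x a) (t : X.graph.Walk b y)
    {p p' : X.graph.Walk a b} (h : X.Backtrack p p') :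
    X.Backtrack (s.append (p.append t)) (s.append (p'.append t)) := by
  obtain ⟨c, d, hcd, s', t', rfl, rfl⟩ := h
  exact ⟨c, d, hcd, s.append s', t'.append t, by simp [← SimpleGraph.Walk.append_assoc],
    by simp [← SimpleGraph.Walk.append_assoc]⟩

theorem CellMove.context {x a b y : V} (s : X.graph.Walk x a) (t : X.graph.Walk b y)
    {p p' : X.graph.Walk a b} (h : X.CellMove p p') :
    X.CellMove (s.append (p.append t)) (s.append (p'.append t)) := by
  obtain ⟨c, d, s', q, q', t', hq, rfl, rfl⟩ := h
  exact ⟨c, d, s.append s', q, q', t'.append t, hq, by simp [← SimpleGraph.Walk.append_assoc],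
    by simp [← SimpleGraph.Walk.append_assoc]⟩

theorem Homotopy.context {x a b y : V} (s : X.graph.Walk x a) (t : X.graph.Walk b y) {N : ℕ}
    {p p' : X.graph.Walk a b} (h : X.Homotopy N p p') :
    X.Homotopy N (s.append (p.append t)) (s.append (p'.append t)) := by
  induction h with
  | refl => exact .refl _
  | insert _ h ih => exact ih.insert (h.context s t)
  | delete _ h ih => exact ih.delete (h.context s t)
  | push _ h ih => exact ih.push (h.context s t)

theorem homotopy_reverse_append {a b : V} (q : X.graph.Walk a b) :
    X.Homotopy 0 .nil (q.reverse.append q) := by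
  induction q with
  | nil => exact .refl _
  | @cons a c b h q ih =>
    refine ih.insert ⟨c, a, h.symm, q.reverse, q, rfl, ?_⟩
    simp [← SimpleGraph.Walk.append_assoc]

/-- Insert q⁻¹q after p, at no cost; contract pq⁻¹ with N₂ cells; what remains is s q t. -/
theorem Homotopy.cut {x a b : V} {N₁ N₂ : ℕ} (s : X.graph.Walk x a) (p q : X.graph.Walk a b)
    (t : X.graph.Walk b x) (H₁ : X.Homotopy N₁ (s.append (q.append t)) .nil)
    (H₂ : X.Homotopy N₂ (p.append q.reverse) .nil) :
    X.Homotopy (N₂ + N₁) (s.append (p.append t)) .nil := by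
  have e₁ := (homotopy_reverse_append q).context (s.append p) t
  have e₂ := H₂.context s (q.append t)
  simp only [SimpleGraph.Walk.nil_append, ← SimpleGraph.Walk.append_assoc] at e₁ e₂ H₁ ⊢
  simpa using e₁.trans (e₂.trans H₁)

end TwoComplex

/-- A nonempty piece of length at most θ is itself the boundary of a cell. Empty pieces cost
nothing, hence an inequality for the count. -/
theorem Fills.homotopy {θ N m x} {w : Γ.Walk x x} (h : Fills Γ θ N m x w) :
    ∃ N' ≤ N, (filling Γ θ).Homotopy N' (x := x) (y := x) w .nil := by
  induction h with
  | @base x m w hw =>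
    rcases Nat.eq_zero_or_pos w.length with h0 | h0
    · rw [SimpleGraph.Walk.eq_nil_iff_nil.2 (SimpleGraph.Walk.length_eq_zero_iff.1 h0)]
      exact ⟨0, by simp, .refl _⟩
    · refine ⟨1, le_rfl, (TwoComplex.Homotopy.refl (X := filling Γ θ) w).push ?_⟩
      refine ⟨x, x, .nil, w, .nil, .nil, ⟨⟨⟨x, w⟩, h0, hw⟩, x, .nil, w, ?_, .inl ?_⟩, ?_, ?_⟩ <;>
        simp [filling]
  | @split N₁ N₂ m x a b s p q t _ _ ih₁ ih₂ =>
    obtain ⟨M₁, hM₁, H₁⟩ := ih₁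
    obtain ⟨M₂, hM₂, H₂⟩ := ih₂
    exact ⟨M₂ + M₁, by omega, TwoComplex.Homotopy.cut (X := filling Γ θ) s p q t H₁ H₂⟩

/-- The empty walk is exempted because `Fills` counts at least one piece, whereas the bound n^(log_b
2) vanishes at n = 0. -/
theorem dehn_filling_le {θ n B : ℕ} (h : ∀ (x : V) (w : Γ.Walk x x), w.length ≤ n → 0 < w.length →
    ∃ N m, N ≤ B ∧ Fills Γ θ N m x w) : (filling Γ θ).dehn n ≤ (B : ℕ∞) := by
  refine iSup_le fun x => iSup_le fun w => iSup_le fun hw => ?_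
  have : ∃ N ≤ B, (filling Γ θ).Homotopy N w .nil := by
    rcases Nat.eq_zero_or_pos w.length with h0 | h0
    · rw [SimpleGraph.Walk.eq_nil_iff_nil.2 (SimpleGraph.Walk.length_eq_zero_iff.1 h0)]
      exact ⟨0, by simp, .refl _⟩
    · obtain ⟨N, m, hN, hf⟩ := h x w hw h0
      obtain ⟨N', hN', H⟩ := hf.homotopy
      exact ⟨N', hN'.trans hN, H⟩
  obtain ⟨N, hN, H⟩ := this
  exact (iInf₂_le N H).trans (by exact_mod_cast hN)

/-! ### Cutting closed walks along short chords -/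

theorem exists_split (hΓ : Γ.Connected) {x : V} (w : Γ.Walk x x) {i j : ℕ} (hij : i ≤ j)
    (hj : j ≤ w.length) :
    ∃ (a b : V) (s : Γ.Walk x a) (p q : Γ.Walk a b) (t : Γ.Walk b x),
      w = s.append (p.append t) ∧
      (s.append (q.append t)).length = w.length - (j - i) + Γ.dist (w.getVert i) (w.getVert j) ∧
      (p.append q.reverse).length = j - i + Γ.dist (w.getVert i) (w.getVert j) := by
  have hv : (w.drop i).getVert (j - i) = w.getVert j := by
    rw [SimpleGraph.Walk.drop_getVert]; congr 1; omega
  obtain ⟨q, hq⟩ := hΓ.exists_walk_length_eq_dist (w.getVert i) ((w.drop i).getVert (j - i))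
  refine ⟨_, _, w.take i, (w.drop i).take (j - i), q, (w.drop i).drop (j - i), ?_, ?_, ?_⟩
  · rw [SimpleGraph.Walk.append_take_drop_eq, SimpleGraph.Walk.append_take_drop_eq]
  · simp only [SimpleGraph.Walk.length_append, SimpleGraph.Walk.take_length,
      SimpleGraph.Walk.drop_length, hq, hv]
    omega
  · simp only [SimpleGraph.Walk.length_append, SimpleGraph.Walk.take_length,
      SimpleGraph.Walk.drop_length, SimpleGraph.Walk.length_reverse, hq, hv]
    omega

theorem dist_getVert_le {x y : V} (w : Γ.Walk x y) {i j : ℕ} (hij : i ≤ j) :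
    Γ.dist (w.getVert i) (w.getVert j) ≤ j - i := by
  have hv : (w.drop i).getVert (j - i) = w.getVert j := by
    rw [SimpleGraph.Walk.drop_getVert]; congr 1; omega
  have := SimpleGraph.dist_le ((w.drop i).take (j - i))
  simp only [hv, SimpleGraph.Walk.take_length] at this
  omega

/-- The complementary arc runs from position j to the end of the walk, which is the base point, and
on to position i. -/
theorem dist_getVert_le_compl (hΓ : Γ.Connected) {x : V} (w : Γ.Walk x x) {i j : ℕ}
    (hj : j ≤ w.length) :
    Γ.dist (w.getVert i) (w.getVert j) ≤ w.length - j + i := by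
  have h₁ := dist_getVert_le w (Nat.zero_le i)
  have h₂ := dist_getVert_le w hj
  rw [SimpleGraph.Walk.getVert_length] at h₂
  rw [SimpleGraph.Walk.getVert_zero] at h₁
  have h₃ := hΓ.dist_triangle (u := w.getVert i) (v := x) (w := w.getVert j)
  rw [Γ.dist_comm (u := w.getVert i) (v := x), Γ.dist_comm (u := x) (v := w.getVert j)] at h₃
  omega

/-! ### Points of cycles -/

/-- Splits a real parameter into an edge index, an offset in that edge and a number of full turns.
-/
theorem exists_cyclePoint_eq {x : V} (w : Γ.Walk x x) (hw : 0 < w.length) (a : ℝ) :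
    ∃ (i : ℕ) (s : ℝ) (k : ℤ), i < w.length ∧ 0 ≤ s ∧ s < 1 ∧ a = i + s + k * w.length ∧
      cyclePoint w a = ((w.getVert i, w.getVert (i + 1)), s) := by
  have hn : (0 : ℤ) < w.length := by exact_mod_cast hw
  have h0 := Int.emod_nonneg ⌊a⌋ hn.ne'
  have h1 := Int.emod_lt_of_pos ⌊a⌋ hn
  refine ⟨(⌊a⌋ % (w.length : ℤ)).toNat, Int.fract a, ⌊a⌋ / (w.length : ℤ), by omega,
    Int.fract_nonneg a, Int.fract_lt_one a, ?_, rfl⟩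
  have h2 : (((⌊a⌋ % (w.length : ℤ)).toNat : ℤ) : ℝ) + ((⌊a⌋ / (w.length : ℤ) : ℤ) : ℝ) * w.length
      = ⌊a⌋ := by
    rw [Int.toNat_of_nonneg h0]
    have := Int.emod_add_mul_ediv ⌊a⌋ (w.length : ℤ)
    rw [mul_comm] at this
    exact_mod_cast this
  have h3 := Int.floor_add_fract a
  rw [Int.cast_natCast] at h2
  linarith

theorem norm_addCircle_eq_min {n x : ℝ} (hn : 0 < n) (hx : |x| ≤ n) :
    ‖(x : AddCircle n)‖ = min |x| (n - |x|) := by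
  have key : ∀ y : ℝ, 0 ≤ y → y ≤ n → ‖(y : AddCircle n)‖ = min y (n - y) := by
    intro y h0 h1
    rcases le_total y (n / 2) with h | h
    · rw [(AddCircle.norm_coe_eq_abs_iff n hn.ne').2 (by rwa [abs_of_nonneg h0, abs_of_pos hn]),
        abs_of_nonneg h0, min_eq_left (by linarith)]
    -- Beyond half a turn, subtract a period to reach the range where the norm is the absolute
    -- value.
    · have : (y : AddCircle n) = ((y - n : ℝ) : AddCircle n) := by
        rw [AddCircle.coe_sub, AddCircle.coe_period, sub_zero]
      rw [this, (AddCircle.norm_coe_eq_abs_iff n hn.ne').2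
        (by rw [abs_of_nonpos (by linarith), abs_of_pos hn]; linarith),
        abs_of_nonpos (by linarith), min_eq_right (by linarith)]
      ring
  rcases le_total 0 x with h | h
  · rw [abs_of_nonneg h] at hx ⊢
    exact key x h hx
  · rw [abs_of_nonpos h] at hx ⊢
    rw [← norm_neg, ← AddCircle.coe_neg]
    exact key (-x) (by linarith) hx

theorem dist_addCircle_eq {n a b x y : ℝ} {k l : ℤ} (hn : 0 < n) (ha : a = x + k * n)
    (hb : b = y + l * n) (hxy : |x - y| ≤ n) :
    dist (a : AddCircle n) (b : AddCircle n) = min |x - y| (n - |x - y|) := by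
  have h : ∀ (z : ℝ) (k : ℤ), ((z + k * n : ℝ) : AddCircle n) = z := by
    intro z k
    rw [AddCircle.coe_add, ← zsmul_eq_mul, AddCircle.coe_zsmul, AddCircle.coe_period, smul_zero,
      add_zero]
  rw [ha, hb, h, h, dist_eq_norm, ← AddCircle.coe_sub, norm_addCircle_eq_min hn hxy]

/-- A closed walk that preserves the distances between vertices is an isometric cycle. -/
theorem isIsometricCycle_of_dist {x : V} (w : Γ.Walk x x) (hw : 3 ≤ w.length)
    (hd : ∀ i j : ℕ, i ≤ j → j ≤ w.length →
      (Γ.dist (w.getVert i) (w.getVert j) : ℝ) = min ((j : ℝ) - i) (w.length - (j - i))) :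
    IsIsometricCycle w := by
  have hn : (3 : ℝ) ≤ w.length := by exact_mod_cast hw
  have hinj : ∀ i j : ℕ, i < w.length → j < w.length → w.getVert i = w.getVert j → i = j := by
    have : ∀ i j : ℕ, i < j → j < w.length → w.getVert i ≠ w.getVert j := by
      intro i j hij hj h
      have := hd i j hij.le hj.le
      rw [h, SimpleGraph.dist_self] at this
      have h1 : (i : ℝ) < j := by exact_mod_cast hij
      have h2 : (j : ℝ) < w.length := by exact_mod_cast hj
      have h3 : (0 : ℝ) ≤ i := by positivity
      have : (0 : ℝ) < min ((j : ℝ) - i) (w.length - (j - i)) := lt_min (by linarith) (by linarith)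
      simp_all
    intro i j hi hj h
    rcases lt_trichotomy i j with hij | hij | hij
    · exact absurd h (this i j hij hj)
    · exact hij
    · exact absurd h.symm (this j i hij hi)
  have hsucc : ∀ i j : ℕ, i < w.length → j < w.length → w.getVert i = w.getVert (j + 1) →
      i = j + 1 ∨ (i = 0 ∧ j + 1 = w.length) := by
    intro i j hi hj h
    rcases Nat.lt_or_ge (j + 1) w.length with h1 | h1
    · exact .inl (hinj _ _ hi h1 h)
    · have h2 : j + 1 = w.length := by omega
      rw [h2, SimpleGraph.Walk.getVert_length] at h
      exact .inr ⟨hinj _ _ hi (by omega) (h.trans w.getVert_zero.symm), h2⟩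
  have hlt : ∀ (i j : ℕ) (s t : ℝ), i < j → j < w.length → 0 ≤ s → s < 1 → 0 ≤ t → t < 1 →
      min (min (s + Γ.dist (w.getVert i) (w.getVert j) + t)
          (s + Γ.dist (w.getVert i) (w.getVert (j + 1)) + (1 - t)))
        (min ((1 - s) + Γ.dist (w.getVert (i + 1)) (w.getVert j) + t)
          ((1 - s) + Γ.dist (w.getVert (i + 1)) (w.getVert (j + 1)) + (1 - t))) =
      min ((j + t) - (i + s)) (w.length - ((j + t) - (i + s))) := by
    intro i j s t hij hj hs0 hs1 ht0 ht1
    have h1 : (i : ℝ) + 1 ≤ j := by exact_mod_cast hij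
    have h2 : (j : ℝ) + 1 ≤ w.length := by exact_mod_cast hj
    have h3 : (0 : ℝ) ≤ i := by positivity
    rw [hd i j hij.le hj.le, hd i (j + 1) (by omega) (by omega), hd (i + 1) j (by omega) hj.le,
      hd (i + 1) (j + 1) (by omega) (by omega)]
    push_cast
    apply le_antisymm
    -- The forward arc is the route from i + 1 to j, the complementary arc the route from i to j +
    -- 1.
    · refine le_min ?_ ?_
      · refine (min_le_right _ _).trans ((min_le_left _ _).trans ?_)
        have := min_le_left ((j : ℝ) - (i + 1)) (w.length - (j - (i + 1)))
        linarith
      · refine (min_le_left _ _).trans ((min_le_right _ _).trans ?_)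
        have := min_le_right ((j : ℝ) + 1 - i) (w.length - (j + 1 - i))
        linarith
    · have hl := min_le_left ((j : ℝ) + t - (i + s)) (w.length - (j + t - (i + s)))
      have hr := min_le_right ((j : ℝ) + t - (i + s)) (w.length - (j + t - (i + s)))
      refine le_min (le_min ?_ ?_) (le_min ?_ ?_)
      · rcases min_choice ((j : ℝ) - i) (w.length - (j - i)) with h | h <;> rw [h] <;> linarith
      · rcases min_choice ((j : ℝ) + 1 - i) (w.length - (j + 1 - i)) with h | h <;> rw [h] <;>
          linarith
      · rcases min_choice ((j : ℝ) - (i + 1)) (w.length - (j - (i + 1))) with h | h <;> rw [h] <;>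
          linarith
      · rcases min_choice ((j : ℝ) + 1 - (i + 1)) (w.length - (j + 1 - (i + 1))) with h | h <;>
          rw [h] <;> linarith
  refine ⟨by omega, fun a b => ?_⟩
  obtain ⟨i, s, k, hi, hs0, hs1, ha, hpa⟩ := exists_cyclePoint_eq w (by omega) a
  obtain ⟨j, t, l, hj, ht0, ht1, hb, hpb⟩ := exists_cyclePoint_eq w (by omega) b
  have hi' : (i : ℝ) + 1 ≤ w.length := by exact_mod_cast hi
  have hj' : (j : ℝ) + 1 ≤ w.length := by exact_mod_cast hj
  have hi0 : (0 : ℝ) ≤ i := by positivity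
  have hj0 : (0 : ℝ) ≤ j := by positivity
  rw [dist_addCircle_eq (by linarith) ha hb (abs_le.2 ⟨by linarith, by linarith⟩), hpa, hpb,
    pointDist]
  rcases eq_or_ne i j with rfl | hne
  · simp only [if_true]
    rw [show (i : ℝ) + s - (i + t) = s - t by ring, min_eq_left]
    have : |s - t| ≤ 1 := abs_le.2 ⟨by linarith, by linarith⟩
    linarith
  · rw [if_neg, if_neg]
    · simp only
      rcases lt_or_gt_of_ne hne with hij | hij
      · have h1 : (i : ℝ) + 1 ≤ j := by exact_mod_cast hij
        rw [hlt i j s t hij hj hs0 hs1 ht0 ht1, abs_of_nonpos (by linarith), neg_sub]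
      · have h1 : (j : ℝ) + 1 ≤ i := by exact_mod_cast hij
        -- Exchanging the two points permutes the two middle routes.
        rw [abs_of_nonneg (by linarith), ← hlt j i t s hij hi ht0 ht1 hs0 hs1, min_min_min_comm]
        simp only [Γ.dist_comm (u := w.getVert j), Γ.dist_comm (u := w.getVert (j + 1))]
        congr 2 <;> ring
    · simp only [Prod.swap_prod_mk, Prod.mk.injEq, not_and]
      intro h1 h2
      have h1 := hsucc _ _ hj hi h1
      have h2 := hsucc _ _ hi hj h2.symm
      -- Two distinct edges with swapped ends would force length 2, a walk that retraces one edge;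
      -- this is where length at least 3 is needed.
      omega
    · simp only [Prod.mk.injEq, not_and]
      intro h
      exact absurd (hinj _ _ hj hi h).symm hne

/-! ### Shortcut graphs -/

theorem exists_shortcut_of_not_isIsometricCycle (hΓ : Γ.Connected) {x : V} (w : Γ.Walk x x)
    (hw : 3 ≤ w.length) (h : ¬ IsIsometricCycle w) :
    ∃ i j : ℕ, i ≤ j ∧ j ≤ w.length ∧ Γ.dist (w.getVert i) (w.getVert j) < j - i ∧
      Γ.dist (w.getVert i) (w.getVert j) + (j - i) < w.length := by
  by_contra hcon
  refine h (isIsometricCycle_of_dist w hw fun i j hij hj => ?_)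
  have h1 := dist_getVert_le w hij
  have h2 := dist_getVert_le_compl hΓ w (i := i) hj
  have h3 : Γ.dist (w.getVert i) (w.getVert j) = min (j - i) (w.length - (j - i)) := by
    by_contra hne
    exact hcon ⟨i, j, hij, hj, by omega, by omega⟩
  rw [h3]
  push_cast [Nat.cast_sub hij, Nat.cast_sub (show j - i ≤ w.length by omega)]
  rfl

/-- Both pieces lose at least one edge, so the weight 2^n satisfies the recursion of `exists_fills`.
-/
theorem exists_fills_of_isShortcut (hΓ : IsShortcut Γ) :
    ∃ θ₀ : ℕ, ∀ θ ≥ θ₀, ∀ (x : V) (w : Γ.Walk x x),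
      ∃ N : ℕ, N ≤ 2 ^ w.length ∧ Fills Γ θ N w.length x w := by
  obtain ⟨hconn, θ₀, h⟩ := hΓ
  refine ⟨max θ₀ 3, fun θ hθ x w => ?_⟩
  have := exists_fills (Γ := Γ) (θ := θ) (fun n => (2 : ℝ) ^ n)
    (fun n => one_le_pow₀ (by norm_num)) ?_ w.length x w le_rfl
  · obtain ⟨N, hN, hf⟩ := this
    exact ⟨N, by exact_mod_cast hN, hf⟩
  · intro x w hw
    obtain ⟨i, j, hij, hj, h1, h2⟩ := exists_shortcut_of_not_isIsometricCycle hconn w (by omega)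
      fun hi => by have := h x w hi; omega
    obtain ⟨a, b, s, p, q, t, hw', hs, hp⟩ := exists_split hconn w hij hj
    refine ⟨a, b, s, p, q, t, hw', by omega, by omega, ?_⟩
    obtain ⟨n, hn⟩ : ∃ n, w.length = n + 1 := ⟨w.length - 1, by omega⟩
    rw [hn, pow_succ, mul_two]
    exact add_le_add (pow_le_pow_right₀ (by norm_num) (by omega))
      (pow_le_pow_right₀ (by norm_num) (by omega))

/-! ### Strongly shortcut graphs -/

/-- Rounds two points to ends of their edges without increasing the distance: a shortest route
passes through such ends, and points of a common edge round to the same vertex. -/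
theorem exists_dist_le_pointDist {a b c d : V} {s t : ℝ} (hs0 : 0 ≤ s) (hs1 : s < 1) (ht0 : 0 ≤ t)
    (ht1 : t < 1) :
    ∃ y ∈ ({(a, c), (a, d), (b, c), (b, d)} : Set (V × V)),
      (Γ.dist y.1 y.2 : ℝ) ≤ pointDist Γ ((a, b), s) ((c, d), t) := by
  rw [pointDist]
  split_ifs with h1 h2
  · refine ⟨(a, c), by simp, ?_⟩
    have : c = a := congrArg Prod.fst h1
    simp [this]
  · refine ⟨(a, d), by simp, ?_⟩
    have : d = a := congrArg Prod.snd h2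
    simp [this]
  · simp only
    rcases min_choice (min (s + (Γ.dist a c : ℝ) + t) (s + Γ.dist a d + (1 - t)))
      (min ((1 - s) + (Γ.dist b c : ℝ) + t) ((1 - s) + Γ.dist b d + (1 - t))) with h | h <;> rw [h]
    · rcases min_choice (s + (Γ.dist a c : ℝ) + t) (s + Γ.dist a d + (1 - t)) with h | h <;> rw [h]
      · exact ⟨(a, c), by simp, by simp only; linarith⟩
      · exact ⟨(a, d), by simp, by simp only; linarith⟩
    · rcases min_choice ((1 - s) + (Γ.dist b c : ℝ) + t) ((1 - s) + Γ.dist b d + (1 - t)) with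
        h | h <;> rw [h]
      · exact ⟨(b, c), by simp, by simp only; linarith⟩
      · exact ⟨(b, d), by simp, by simp only; linarith⟩

theorem exists_shortcut_of_not_isAlmostIsometricCycle {ξ : ℝ} {x : V} (w : Γ.Walk x x)
    (hw : 0 < w.length) (h : ¬ IsAlmostIsometricCycle ξ w) :
    ∃ i j : ℕ, i ≤ j ∧ j ≤ w.length ∧
      (Γ.dist (w.getVert i) (w.getVert j) : ℝ) < ξ * (w.length / 2) ∧
      |(j : ℝ) - i - w.length / 2| ≤ 2 := by
  rw [IsAlmostIsometricCycle, not_and] at h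
  obtain ⟨a, ha⟩ := not_forall.1 (h hw)
  rw [not_le] at ha
  obtain ⟨i, s, k, hi, hs0, hs1, hai, hpa⟩ := exists_cyclePoint_eq w hw a
  obtain ⟨j, t, l, hj, ht0, ht1, haj, hpb⟩ := exists_cyclePoint_eq w hw (a + w.length / 2)
  rw [hpa, hpb] at ha
  obtain ⟨y, hy, hyd⟩ := exists_dist_le_pointDist (Γ := Γ) (a := w.getVert i)
    (b := w.getVert (i + 1)) (c := w.getVert j) (d := w.getVert (j + 1)) hs0 hs1 ht0 ht1
  have hd := hyd.trans_lt ha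
  obtain ⟨i', j', hi', hj', rfl⟩ : ∃ i' j' : ℕ, (i' = i ∨ i' = i + 1) ∧ (j' = j ∨ j' = j + 1) ∧
      y = (w.getVert i', w.getVert j') := by
    rcases hy with rfl | rfl | rfl | rfl
    · exact ⟨_, _, .inl rfl, .inl rfl, rfl⟩
    · exact ⟨_, _, .inl rfl, .inr rfl, rfl⟩
    · exact ⟨_, _, .inr rfl, .inl rfl, rfl⟩
    · exact ⟨_, _, .inr rfl, .inr rfl, rfl⟩
  have hil : (i : ℝ) + 1 ≤ w.length := by exact_mod_cast hi
  have hjl : (j : ℝ) + 1 ≤ w.length := by exact_mod_cast hj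
  have hi0 : (0 : ℝ) ≤ i := by positivity
  have hj0 : (0 : ℝ) ≤ j := by positivity
  have hn : (0 : ℝ) < w.length := by exact_mod_cast hw
  have hkl : ((j : ℝ) + t) - (i + s) = w.length / 2 + ((k - l : ℤ) : ℝ) * w.length := by
    push_cast; linarith
  -- Both reduced parameters lie in [0, n) and differ by n/2 modulo n, so their difference is n/2 or
  -- -n/2.
  have hm : k - l = 0 ∨ k - l = -1 := by
    have h1 : ((k - l : ℤ) : ℝ) < 1 := by by_contra hc; nlinarith
    have h2 : (-2 : ℝ) < ((k - l : ℤ) : ℝ) := by by_contra hc; nlinarith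
    have h1 : k - l < 1 := by exact_mod_cast h1
    have h2 : -2 < k - l := by exact_mod_cast h2
    omega
  have hbi : (i : ℝ) ≤ i' ∧ (i' : ℝ) ≤ i + 1 := by
    rcases hi' with rfl | rfl <;> push_cast <;> constructor <;> linarith
  have hbj : (j : ℝ) ≤ j' ∧ (j' : ℝ) ≤ j + 1 := by
    rcases hj' with rfl | rfl <;> push_cast <;> constructor <;> linarith
  have hc : |(j' : ℝ) - i' - w.length / 2| ≤ 2 ∨ |(i' : ℝ) - j' - w.length / 2| ≤ 2 := by
    rcases hm with hm | hm <;> rw [hm] at hkl <;> push_cast at hkl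
    · exact .inl (abs_le.2 ⟨by linarith, by linarith⟩)
    · exact .inr (abs_le.2 ⟨by linarith, by linarith⟩)
  rw [abs_le, abs_le] at hc
  have hjl' : j' ≤ w.length := by omega
  have hil' : i' ≤ w.length := by omega
  -- Rounding may reverse the order of the indices; in that case n/2 plus their gap is at most 2,
  -- and the estimate still holds.
  rcases le_total i' j' with hij | hij
  · have hij' : (i' : ℝ) ≤ j' := by exact_mod_cast hij
    refine ⟨i', j', hij, hjl', hd, abs_le.2 ?_⟩
    rcases hc with hc | hc <;> constructor <;> linarith
  · have hij' : (j' : ℝ) ≤ i' := by exact_mod_cast hij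
    refine ⟨j', i', hij, hil', by rwa [Γ.dist_comm], abs_le.2 ?_⟩
    rcases hc with hc | hc <;> constructor <;> linarith

theorem exists_fills_of_isStronglyShortcut (hΓ : IsStronglyShortcut Γ) :
    ∃ b : ℝ, 1 < b ∧ ∃ θ₀ : ℕ, ∀ θ ≥ θ₀, ∀ (x : V) (w : Γ.Walk x x),
      ∃ N : ℕ, (N : ℝ) ≤ max 1 ((w.length : ℝ) ^ Real.logb b 2) ∧ Fills Γ θ N w.length x w := by
  obtain ⟨hconn, θ₀, ξ, hξ0, hξ1, h⟩ := hΓ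
  have hb : 1 < 4 / (3 + ξ) := by rw [lt_div_iff₀ (by linarith)]; linarith
  -- The pieces have length at most (1 + ξ)n/2 + 2. The ratio 1/b = (3 + ξ)/4 is midway between (1 +
  -- ξ)/2 and 1, and absorbs the 2 once n(1 - ξ) ≥ 8; `M` ensures this.
  set b := 4 / (3 + ξ) with hbdef
  set e := Real.logb b 2 with hedef
  have he : 0 < e := Real.logb_pos hb (by norm_num)
  have hbe : b ^ e = 2 := Real.rpow_logb (by linarith) hb.ne' (by norm_num)
  obtain ⟨M, hM⟩ := exists_nat_ge (8 / (1 - ξ))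
  rw [div_le_iff₀ (by linarith)] at hM
  refine ⟨b, hb, max θ₀ (M + 2), fun θ hθ x w => ?_⟩
  refine exists_fills (Γ := Γ) (θ := θ) (fun n => max 1 ((n : ℝ) ^ e)) (fun n => le_max_left _ _)
    (fun x w hw => ?_) w.length x w le_rfl
  obtain ⟨i, j, hij, hj, h1, h2⟩ := exists_shortcut_of_not_isAlmostIsometricCycle (ξ := ξ) w
    (by omega) fun hi => by have := h x w hi; omega
  obtain ⟨c, d, s, p, q, t, hw', hs, hp⟩ := exists_split hconn w hij hj
  rw [abs_le] at h2
  have hMn : (M : ℝ) + 2 ≤ w.length := by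
    have : M + 2 ≤ w.length := by omega
    exact_mod_cast this
  have hn : 8 ≤ w.length * (1 - ξ) := by nlinarith
  have hn2 : (2 : ℝ) ≤ w.length := by
    have : (0 : ℝ) ≤ M := by positivity
    linarith
  have hnb : (w.length : ℝ) / b = w.length * (3 + ξ) / 4 := by rw [hbdef]; field_simp
  have hs' : ((s.append (q.append t)).length : ℝ) ≤ w.length / b := by
    rw [hs, hnb]
    push_cast [Nat.cast_sub hij, Nat.cast_sub (show j - i ≤ w.length by omega)]
    linarith
  have hp' : ((p.append q.reverse).length : ℝ) ≤ w.length / b := by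
    rw [hp, hnb]
    push_cast [Nat.cast_sub hij]
    linarith
  have hlt : (w.length : ℝ) / b < w.length := div_lt_self (by linarith) hb
  have h1b : 1 ≤ (w.length : ℝ) / b := by
    rw [hnb]; nlinarith
  -- Since b^e = 2, each piece carries at most half the weight.
  have hF : ∀ m : ℕ, (m : ℝ) ≤ w.length / b →
      max 1 ((m : ℝ) ^ e) ≤ (w.length : ℝ) ^ e / 2 := by
    intro m hm
    rw [show (w.length : ℝ) ^ e / 2 = (w.length / b) ^ e by
      rw [Real.div_rpow (by positivity) (by linarith), hbe]]
    exact max_le (Real.one_le_rpow h1b he.le) (Real.rpow_le_rpow (by positivity) hm he.le)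
  refine ⟨c, d, s, p, q, t, hw', by exact_mod_cast hs'.trans_lt hlt,
    by exact_mod_cast hp'.trans_lt hlt, ?_⟩
  have := le_max_right 1 ((w.length : ℝ) ^ e)
  have := hF _ hs'
  have := hF _ hp'
  linarith

theorem dehn_filling_le_of_isShortcut (hΓ : IsShortcut Γ) :
    ∃ θ₀ : ℕ, ∀ θ ≥ θ₀, ∀ n : ℕ, (filling Γ θ).dehn n ≤ ((2 ^ n : ℕ) : ℕ∞) := by
  obtain ⟨θ₀, h⟩ := exists_fills_of_isShortcut hΓ
  refine ⟨θ₀, fun θ hθ n => dehn_filling_le fun x w hw _ => ?_⟩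
  obtain ⟨N, hN, hf⟩ := h θ hθ x w
  exact ⟨N, _, hN.trans (Nat.pow_le_pow_right (by norm_num) hw), hf⟩

theorem dehn_filling_le_of_isStronglyShortcut (hΓ : IsStronglyShortcut Γ) :
    ∃ b : ℝ, 1 < b ∧ ∃ θ₀ : ℕ, ∀ θ ≥ θ₀, ∀ n : ℕ,
      (((filling Γ θ).dehn n : ℕ∞) : ℝ≥0∞) ≤ ENNReal.ofReal ((n : ℝ) ^ Real.logb b 2) := by
  obtain ⟨b, hb, θ₀, h⟩ := exists_fills_of_isStronglyShortcut hΓ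
  have he : 0 < Real.logb b 2 := Real.logb_pos hb (by norm_num)
  refine ⟨b, hb, θ₀, fun θ hθ n => ?_⟩
  have hle : (filling Γ θ).dehn n ≤ ((⌊(n : ℝ) ^ Real.logb b 2⌋₊ : ℕ) : ℕ∞) := by
    refine dehn_filling_le fun x w hw hpos => ?_
    obtain ⟨N, hN, hf⟩ := h θ hθ x w
    have h1 : (1 : ℝ) ≤ w.length := by exact_mod_cast hpos
    rw [max_eq_right (Real.one_le_rpow h1 he.le)] at hN
    exact ⟨N, _, Nat.le_floor (hN.trans (Real.rpow_le_rpow (by positivity)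
      (by exact_mod_cast hw) he.le)), hf⟩
  calc (((filling Γ θ).dehn n : ℕ∞) : ℝ≥0∞)
      ≤ (((⌊(n : ℝ) ^ Real.logb b 2⌋₊ : ℕ) : ℕ∞) : ℝ≥0∞) := ENat.toENNReal_le.2 hle
    _ = ((⌊(n : ℝ) ^ Real.logb b 2⌋₊ : ℕ) : ℝ≥0∞) := by simp
    _ = ENNReal.ofReal (⌊(n : ℝ) ^ Real.logb b 2⌋₊ : ℕ) := by simp
    _ ≤ _ := ENNReal.ofReal_le_ofReal (Nat.floor_le (by positivity))

/-! ### Derivations of words -/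

/-- `Derives B N m u`: the word `u` is obtained from `N` words of `B` by at most `m` nested
replacements of a subword `Q` by a subword `P`, where `P Q⁻¹` was derived before. -/
inductive Derives {α : Type*} (B : Set (List (α × Bool))) : ℕ → ℕ → List (α × Bool) → Prop
  | base (m : ℕ) {u : List (α × Bool)} : u ∈ B → Derives B 1 m u
  | replace {N₁ N₂ m : ℕ} (S P Q T : List (α × Bool)) : Derives B N₁ m (S ++ Q ++ T) →
      Derives B N₂ m (P ++ FreeGroup.invRev Q) → Derives B (N₁ + N₂) (m + 1) (S ++ P ++ T)

/-! ### Products of conjugates of relators -/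

/-- `w` is a product of at most `N` conjugates of elements of `R` and their inverses. -/
def IsRelatorProduct {α : Type} (R : Set (FreeGroup α)) (N : ℕ) (w : FreeGroup α) : Prop :=
  ∃ l : List (FreeGroup α × FreeGroup α), l.length ≤ N ∧ (∀ c ∈ l, c.2 ∈ R ∨ c.2⁻¹ ∈ R) ∧
    (l.map fun c => c.1 * c.2 * c.1⁻¹).prod = w

namespace IsRelatorProduct

variable {α : Type} {R : Set (FreeGroup α)} {N M : ℕ} {w v : FreeGroup α}

theorem relatorArea_le (h : IsRelatorProduct R N w) : relatorArea R w ≤ (N : ℕ∞) := by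
  obtain ⟨l, hl, hR, hw⟩ := h
  exact (iInf_le_of_le l (iInf₂_le hR hw)).trans (by exact_mod_cast hl)

theorem mono (h : IsRelatorProduct R N w) (hNM : N ≤ M) : IsRelatorProduct R M w := by
  obtain ⟨l, hl, h⟩ := h
  exact ⟨l, hl.trans hNM, h⟩

theorem mul (h : IsRelatorProduct R N w) (h' : IsRelatorProduct R M v) :
    IsRelatorProduct R (N + M) (w * v) := by
  obtain ⟨l, hl, hR, rfl⟩ := h
  obtain ⟨l', hl', hR', rfl⟩ := h'
  refine ⟨l ++ l', by simp; omega, fun c hc => ?_, by simp⟩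
  rcases List.mem_append.1 hc with hc | hc
  exacts [hR c hc, hR' c hc]

theorem conj (h : IsRelatorProduct R N w) (g : FreeGroup α) :
    IsRelatorProduct R N (g * w * g⁻¹) := by
  obtain ⟨l, hl, hR, rfl⟩ := h
  refine ⟨l.map fun c => (g * c.1, c.2), by simpa, ?_, ?_⟩
  · intro c hc
    obtain ⟨c', hc', rfl⟩ := List.mem_map.1 hc
    exact hR c' hc'
  · clear hl hR
    induction l with
    | nil => simp
    | cons c l ih =>
      simp only [List.map_cons, List.prod_cons] at ih ⊢
      rw [ih]
      group

theorem inv (h : IsRelatorProduct R N w) : IsRelatorProduct R N w⁻¹ := by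
  obtain ⟨l, hl, hR, rfl⟩ := h
  refine ⟨(l.map fun c => (c.1, c.2⁻¹)).reverse, by simpa, ?_, ?_⟩
  · intro c hc
    obtain ⟨c', hc', rfl⟩ := List.mem_map.1 (List.mem_reverse.1 hc)
    simpa [or_comm] using hR c' hc'
  · clear hl hR
    induction l with
    | nil => simp
    | cons c l ih =>
      simp only [List.map_cons, List.prod_cons, List.reverse_cons, List.map_append,
        List.prod_append, List.map_nil, List.prod_nil] at ih ⊢
      rw [ih]
      group

theorem exists_of_mem_normalClosure (h : w ∈ Subgroup.normalClosure R) :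
    ∃ N, IsRelatorProduct R N w := by
  induction h using Subgroup.closure_induction with
  | mem x hx =>
    obtain ⟨r, hr, hc⟩ := Group.mem_conjugatesOfSet_iff.1 hx
    obtain ⟨g, rfl⟩ := isConj_iff.1 hc
    exact ⟨1, [(g, r)], by simp, by simpa using .inl hr, by simp⟩
  | one => exact ⟨0, [], by simp⟩
  | mul x y _ _ hx hy =>
    obtain ⟨N, hN⟩ := hx
    obtain ⟨M, hM⟩ := hy
    exact ⟨_, hN.mul hM⟩
  | inv x _ hx =>
    obtain ⟨N, hN⟩ := hx
    exact ⟨_, hN.inv⟩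

end IsRelatorProduct

/-- A replacement is the identity SPT = S(PQ⁻¹)S⁻¹ · SQT, so areas add. -/
theorem Derives.isRelatorProduct {α : Type} {B : Set (List (α × Bool))} {R : Set (FreeGroup α)}
    {A : ℕ} (hB : ∀ u ∈ B, IsRelatorProduct R A (FreeGroup.mk u)) {N m : ℕ} {u : List (α × Bool)}
    (h : Derives B N m u) : IsRelatorProduct R (A * N) (FreeGroup.mk u) := by
  induction h with
  | base m hu => simpa using hB _ hu
  | @replace N₁ N₂ m S P Q T _ _ ih₁ ih₂ =>
    have := (ih₂.conj (FreeGroup.mk S)).mul ih₁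
    rw [Nat.mul_add, Nat.add_comm]
    convert this using 1
    simp only [← FreeGroup.mul_mk, ← FreeGroup.inv_mk]
    group

theorem Derives.map_eq_one {α : Type*} {G : Type*} [Group G] (φ : FreeGroup α →* G)
    {B : Set (List (α × Bool))} (hB : ∀ u ∈ B, φ (FreeGroup.mk u) = 1) {N m : ℕ}
    {u : List (α × Bool)} (h : Derives B N m u) : φ (FreeGroup.mk u) = 1 := by
  induction h with
  | base m hu => exact hB _ hu
  | replace S P Q T _ _ ih₁ ih₂ =>
    simp only [← FreeGroup.mul_mk, ← FreeGroup.inv_mk, map_mul, map_inv] at ih₁ ih₂ ⊢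
    rw [mul_inv_eq_one.1 ih₂]
    exact ih₁

/-! ### Words of walks -/

section WalkWord

variable {G : Type u} [Group G] {V : Type v} {Γ : SimpleGraph V} {α : Type}
  (σ : G → List (α × Bool)) (lab : V → G)

open Classical in
/-- The word of an oriented edge, for a labelling of the vertices by group elements and a choice of
words for group elements.  Opposite orientations of an edge have formally inverse words. -/
noncomputable def dartWord (x y : V) : List (α × Bool) :=
  if WellOrderingRel x y then σ ((lab x)⁻¹ * lab y) else FreeGroup.invRev (σ ((lab y)⁻¹ * lab x))

theorem dartWord_swap {x y : V} (h : x ≠ y) :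
    dartWord σ lab y x = FreeGroup.invRev (dartWord σ lab x y) := by
  unfold dartWord
  rcases trichotomous_of WellOrderingRel x y with hxy | hxy | hxy
  · rw [if_pos hxy, if_neg (asymm_of WellOrderingRel hxy)]
  · exact absurd hxy h
  · rw [if_pos hxy, if_neg (asymm_of WellOrderingRel hxy), FreeGroup.invRev_invRev]

/-- The word of a walk. -/
noncomputable def walkWord : ∀ {x y : V}, Γ.Walk x y → List (α × Bool)
  | _, _, .nil => []
  | _, _, @SimpleGraph.Walk.cons _ _ x y _ _ p => dartWord σ lab x y ++ walkWord p

theorem walkWord_append {x y z : V} (p : Γ.Walk x y) (q : Γ.Walk y z) :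
    walkWord σ lab (p.append q) = walkWord σ lab p ++ walkWord σ lab q := by
  induction p with
  | nil => simp [walkWord]
  | cons h p ih => simp [walkWord, ih]

/-- This is an equality of words, not just of group elements, as `Derives` never performs free
reduction. -/
theorem walkWord_reverse {x y : V} (p : Γ.Walk x y) :
    walkWord σ lab p.reverse = FreeGroup.invRev (walkWord σ lab p) := by
  induction p with
  | nil => simp [walkWord]
  | cons h p ih =>
    simp [walkWord, walkWord_append, ih, dartWord_swap σ lab h.ne]

variable {σ lab}

theorem map_walkWord {φ : FreeGroup α →* G} (hσ : ∀ g, φ (FreeGroup.mk (σ g)) = g) {x y : V} (p : Γ.Walk x y) :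
    φ (FreeGroup.mk (walkWord σ lab p)) = (lab x)⁻¹ * lab y := by
  induction p with
  | nil => simp [walkWord, ← FreeGroup.one_eq_mk]
  | @cons x y z h p ih =>
    have : φ (FreeGroup.mk (dartWord σ lab x y)) = (lab x)⁻¹ * lab y := by
      unfold dartWord
      split_ifs
      · exact hσ _
      · rw [← FreeGroup.inv_mk, map_inv, hσ]; group
    rw [walkWord, ← FreeGroup.mul_mk, map_mul, ih, this]
    group

end WalkWord

theorem finite_walkWord {G : Type u} [Group G] {V : Type v} {Γ : SimpleGraph V} {α : Type}
    (σ : G → List (α × Bool)) (lab : V → G) {S : Set G} (hS : S.Finite)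
    (hlab : ∀ x y, Γ.Adj x y → (lab x)⁻¹ * lab y ∈ S) (n : ℕ) :
    {u | ∃ (x y : V) (w : Γ.Walk x y), w.length ≤ n ∧ walkWord σ lab w = u}.Finite := by
  have hD : (σ '' S ∪ FreeGroup.invRev '' (σ '' S)).Finite :=
    (hS.image _).union ((hS.image _).image _)
  induction n with
  | zero =>
    refine (Set.finite_singleton []).subset ?_
    rintro _ ⟨x, y, w, hw, rfl⟩
    cases w with
    | nil => simp [walkWord]
    | cons h p => simp at hw
  | succ n ih =>
    refine (((hD.image2 (· ++ ·) ih)).union (Set.finite_singleton [])).subset ?_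
    rintro _ ⟨x, y, w, hw, rfl⟩
    cases w with
    | nil => simp [walkWord]
    | @cons x z y h p =>
      refine .inl ⟨dartWord σ lab x z, ?_, walkWord σ lab p, ⟨_, _, p, by simpa using hw, rfl⟩, rfl⟩
      unfold dartWord
      split_ifs
      · exact .inl ⟨_, hlab _ _ h, rfl⟩
      · exact .inr ⟨_, ⟨_, hlab _ _ h.symm, rfl⟩, rfl⟩

theorem Fills.derives {G : Type u} [Group G] {V : Type v} {Γ : SimpleGraph V} {α : Type}
    {σ : G → List (α × Bool)} {lab : V → G} {θ : ℕ} {B : Set (List (α × Bool))}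
    (hB : ∀ (x : V) (w : Γ.Walk x x), w.length ≤ θ → walkWord σ lab w ∈ B) {N m : ℕ} {x : V}
    {w : Γ.Walk x x} (h : Fills Γ θ N m x w) : Derives B N m (walkWord σ lab w) := by
  induction h with
  | base m w hw => exact .base m (hB _ w hw)
  | split s p q t _ _ ih₁ ih₂ =>
    simp only [walkWord_append, walkWord_reverse, ← List.append_assoc] at ih₁ ih₂ ⊢
    exact .replace _ _ _ _ ih₁ ih₂

/-! ### Proper and cocompact actions -/

section Action

variable {G : Type u} [Group G] {V : Type v} [MulAction G V] {Γ : SimpleGraph V}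

/-- Label x by the inverse of an element carrying x into a finite set K. Labels of adjacent vertices
are compared through an element carrying both ends into K at once, and properness leaves finitely
many quotients. -/
theorem IsProperCocompactAction.exists_labelling (h : IsProperCocompactAction G Γ) (x₀ : V) :
    ∃ (S : Set G) (lab : V → G), S.Finite ∧ (∀ g, g⁻¹ * lab (g • x₀) ∈ S) ∧
      ∀ x y, Γ.Adj x y → (lab x)⁻¹ * lab y ∈ S := by
  obtain ⟨K₀, hK₀, hv, he⟩ := h.cocompact
  -- With x₀ in K, the element g is itself an admissible label of g • x₀.
  set K := insert x₀ K₀ with hK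
  have hsub : K₀ ⊆ K := Set.subset_insert _ _
  set S := {g : G | ∃ x ∈ K, g • x ∈ K} with hS
  have hSfin : S.Finite := h.proper K (hK₀.insert x₀)
  choose g hg using hv
  have hlab : ∀ x, ((g x)⁻¹)⁻¹ • x ∈ K := fun x => by simpa using hsub (hg x)
  have key : ∀ (a b : G) (x : V), a⁻¹ • x ∈ K → b⁻¹ • x ∈ K → a⁻¹ * b ∈ S := fun a b x ha hb =>
    ⟨b⁻¹ • x, hb, by simpa [mul_smul] using ha⟩
  refine ⟨S ∪ Set.image2 (· * ·) S S, fun x => (g x)⁻¹, hSfin.union (hSfin.image2 _ hSfin), ?_, ?_⟩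
  · exact fun a => .inl (key _ _ (a • x₀) (by simp [hK]) (hlab _))
  · intro x y hxy
    obtain ⟨a, hax, hay⟩ := he x y hxy
    refine .inr ⟨_, key _ a⁻¹ x (hlab x) (by simpa using hsub hax), _,
      key a⁻¹ _ y (by simpa using hsub hay) (hlab y), ?_⟩
    simp [mul_assoc]

theorem IsProperCocompactAction.fg (h : IsProperCocompactAction G Γ) (hΓ : Γ.Connected) :
    Group.FG G := by
  obtain ⟨x₀⟩ := hΓ.nonempty
  obtain ⟨S, lab, hS, hS₀, hadj⟩ := h.exists_labelling x₀
  have hw : ∀ (x y : V) (w : Γ.Walk x y), (lab x)⁻¹ * lab y ∈ Subgroup.closure S := by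
    intro x y w
    induction w with
    | nil => simp [one_mem]
    | @cons x y z hxy _ ih =>
      have := mul_mem (Subgroup.subset_closure (hadj _ _ hxy)) ih
      simpa [mul_assoc] using this
  refine Group.fg_iff.2 ⟨S, ?_, hS⟩
  refine (Subgroup.eq_top_iff' _).2 fun g => ?_
  obtain ⟨w⟩ := hΓ.preconnected x₀ (g • x₀)
  have h₁ := Subgroup.subset_closure (hS₀ 1)
  have h₂ := Subgroup.subset_closure (hS₀ g)
  have := mul_mem (mul_mem h₁ (hw _ _ w)) (inv_mem h₂)
  simpa [mul_assoc] using this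

/-- The connecting word between a group element and the label of its orbit point slides past the
letters of `l` one at a time, each costing one word of `B` and one level of depth. The context `X`,
`Z` is arbitrary so that letters already restored can join `X`. -/
theorem exists_walk_derives {α : Type} {φ : FreeGroup α →* G} {σ : G → List (α × Bool)}
    {lab : V → G} {x₀ : V} {d : ℕ} {B : Set (List (α × Bool))}
    (hd : ∀ (s : α × Bool) (h g : G), g = h * φ (FreeGroup.mk [s]) →
      ∃ c : Γ.Walk (h • x₀) (g • x₀), c.length ≤ d ∧
        [s] ++ σ (g⁻¹ * lab (g • x₀)) ++
          FreeGroup.invRev (σ (h⁻¹ * lab (h • x₀)) ++ walkWord σ lab c) ∈ B)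
    (l : List (α × Bool)) : ∀ h g : G, g = h * φ (FreeGroup.mk l) →
      ∃ w : Γ.Walk (h • x₀) (g • x₀), w.length ≤ d * l.length ∧
        ∀ (X Z : List (α × Bool)) (N m : ℕ),
          Derives B N m (X ++ (σ (h⁻¹ * lab (h • x₀)) ++ walkWord σ lab w) ++ Z) →
          Derives B (N + l.length) (m + l.length) (X ++ (l ++ σ (g⁻¹ * lab (g • x₀))) ++ Z) := by
  induction l with
  | nil =>
    intro h g hg
    obtain rfl : g = h := by rw [hg, ← FreeGroup.one_eq_mk, map_one, mul_one]
    exact ⟨.nil, by simp, fun X Z N m H => by simpa [walkWord] using H⟩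
  | cons s l ih =>
    intro h g hg
    obtain ⟨c, hc, hcB⟩ := hd s h _ rfl
    obtain ⟨w, hw, H⟩ := ih (h * φ (FreeGroup.mk [s])) g (by
      rw [hg, mul_assoc, ← map_mul, FreeGroup.mul_mk]; rfl)
    refine ⟨c.append w, by simp [mul_add]; omega, fun X Z N m hD => ?_⟩
    have h₁ := Derives.replace (B := B) X _ _ (walkWord σ lab w ++ Z)
      (by simpa [walkWord_append] using hD) (.base m hcB)
    have h₂ := H (X ++ [s]) Z _ _ (by simpa using h₁)
    convert h₂ using 1
    · simp; omega
    · simp; omega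
    · simp

/-- Every word that represents the identity is derived from a closed walk of proportional length and
finitely many relators. -/
theorem IsProperCocompactAction.exists_derives (h : IsProperCocompactAction G Γ)
    (hΓ : Γ.Connected) {α : Type} [Finite α] (φ : FreeGroup α →* G) (hφ : Function.Surjective φ)
    (θ : ℕ) :
    ∃ (B : Set (List (α × Bool))) (d : ℕ), B.Finite ∧ (∀ u ∈ B, φ (FreeGroup.mk u) = 1) ∧
      ∀ l, φ (FreeGroup.mk l) = 1 → ∃ (x : V) (w : Γ.Walk x x), w.length ≤ d * l.length ∧
        ∀ N m, Fills Γ θ N m x w → Derives B (N + l.length + 2) (m + l.length + 2) l := by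
  classical
  obtain ⟨x₀⟩ := hΓ.nonempty
  obtain ⟨S, lab, hS, hS₀, hadj⟩ := h.exists_labelling x₀
  choose τ hτ using hφ
  set σ : G → List (α × Bool) := fun g => (τ g).toWord with hσdef
  have hσ : ∀ g, φ (FreeGroup.mk (σ g)) = g := fun g => by simp [hσdef, FreeGroup.mk_toWord, hτ]
  have hd₀ : ∃ d, ∀ s : α × Bool, Γ.dist x₀ (φ (FreeGroup.mk [s]) • x₀) ≤ d := by
    obtain ⟨d, hd⟩ := (Set.finite_range fun s : α × Bool =>
      Γ.dist x₀ (φ (FreeGroup.mk [s]) • x₀)).bddAbove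
    exact ⟨d, fun s => hd ⟨s, rfl⟩⟩
  obtain ⟨d, hd⟩ := hd₀
  have hwalk : ∀ (s : α × Bool) (h' g : G), g = h' * φ (FreeGroup.mk [s]) →
      ∃ c : Γ.Walk (h' • x₀) (g • x₀), c.length ≤ d := by
    rintro s h' g rfl
    -- Translating a geodesic from the base point makes the bound `d` independent of h'.
    obtain ⟨c, hc⟩ := hΓ.exists_walk_length_eq_dist x₀ (φ (FreeGroup.mk [s]) • x₀)
    let f : Γ →g Γ := ⟨fun x => h' • x, fun hxy => h.adj_smul h' _ _ hxy⟩
    refine ⟨(c.map f).copy rfl (by simp [f, mul_smul]), ?_⟩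
    simpa [hc] using hd s
  have hfin := finite_walkWord (Γ := Γ) σ lab hS hadj
  set W : ℕ → Set (List (α × Bool)) := fun n =>
    {u | ∃ (x y : V) (w : Γ.Walk x y), w.length ≤ n ∧ walkWord σ lab w = u} with hW
  set E₁ : Set (List (α × Bool)) := (fun z : (G × G) × (α × Bool) × List (α × Bool) =>
    [z.2.1] ++ σ z.1.1 ++ FreeGroup.invRev (σ z.1.2 ++ z.2.2)) ''
      ((S ×ˢ S) ×ˢ (Set.univ ×ˢ W d)) with hE₁
  set E₂ : Set (List (α × Bool)) := (fun a => σ a ++ FreeGroup.invRev (σ a)) '' S with hE₂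
  -- `E₁` holds the relators for single letters, `E₂` the cancellations σ(a)σ(a)⁻¹, and `W θ` the
  -- words of the short pieces.
  set B : Set (List (α × Bool)) := {u ∈ E₁ ∪ E₂ ∪ W θ | φ (FreeGroup.mk u) = 1} with hB
  have hBfin : B.Finite := by
    refine Set.Finite.subset ((Set.Finite.union ?_ ?_).union (hfin θ)) (Set.sep_subset _ _)
    · exact ((hS.prod hS).prod (Set.finite_univ.prod (hfin d))).image _
    · exact hS.image _
  have hE₂B : ∀ a ∈ S, σ a ++ FreeGroup.invRev (σ a) ∈ B := fun a ha =>
    ⟨.inl (.inr ⟨a, ha, rfl⟩), by simp [← FreeGroup.mul_mk, ← FreeGroup.inv_mk]⟩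
  refine ⟨B, d, hBfin, fun u hu => hu.2, fun l hl => ?_⟩
  obtain ⟨w, hw, H⟩ := exists_walk_derives (Γ := Γ) (φ := φ) (σ := σ) (lab := lab) (x₀ := x₀)
    (d := d) (B := B) (fun s h' g hg => by
      obtain ⟨c, hc⟩ := hwalk s h' g hg
      refine ⟨c, hc, .inl (.inl ⟨((_, _), (s, _)), ⟨⟨hS₀ g, hS₀ h'⟩, Set.mem_univ _,
        ⟨_, _, c, hc, rfl⟩⟩, rfl⟩), ?_⟩
      simp only [← FreeGroup.mul_mk, ← FreeGroup.inv_mk, map_mul, map_inv, hσ,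
        map_walkWord hσ]
      rw [hg]
      group) l 1 1 (by rw [hl, mul_one])
  refine ⟨_, w, hw, fun N m hf => ?_⟩
  have hfd := hf.derives (σ := σ) (lab := lab) (B := B) fun x c hc =>
    ⟨.inr ⟨_, _, c, hc, rfl⟩, by rw [map_walkWord hσ]; group⟩
  -- With c the connecting word at the identity: insert the walk word into cc⁻¹, slide c along to
  -- get l cc⁻¹, then remove cc⁻¹. The two uses of cc⁻¹ give the summand 2.
  have h₁ := Derives.replace (B := B) (σ (1⁻¹ * lab ((1 : G) • x₀))) (walkWord σ lab w) []
    (FreeGroup.invRev (σ (1⁻¹ * lab ((1 : G) • x₀)))) (.base m (by simpa using hE₂B _ (hS₀ 1)))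
    (by simpa using hfd)
  have h₂ := H [] _ _ _ h₁
  have h₃ := Derives.replace (B := B) l []
    (σ (1⁻¹ * lab ((1 : G) • x₀)) ++ FreeGroup.invRev (σ (1⁻¹ * lab ((1 : G) • x₀)))) []
    (by simpa using h₂) (.base _ (by simpa using hE₂B _ (hS₀ 1)))
  convert h₃ using 1
  · omega
  · omega
  · simp

/-- The finite set `B` of `exists_derives` presents G. Over any other finite presentation with the
same φ, its words have area at most some A, which multiplies the bound. -/
theorem IsProperCocompactAction.hasIsoperimetricFunction (h : IsProperCocompactAction G Γ)
    (hΓ : Γ.Connected) {θ : ℕ} {F : ℕ → ℕ} (hF : Monotone F)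
    (hfill : ∀ (x : V) (w : Γ.Walk x x), ∃ N m, N ≤ F w.length ∧ Fills Γ θ N m x w)
    {P : (ℕ → ℕ) → Prop}
    (hP : ∀ A d : ℕ, ∃ f, P f ∧ ∀ n, A * (F (d * n) + n + 2) ≤ f n) :
    HasIsoperimetricFunction G P := by
  have key : ∀ (k : ℕ) (φ : FreeGroup (Fin k) →* G), Function.Surjective φ →
      ∃ (B : Set (List (Fin k × Bool))) (d : ℕ), B.Finite ∧ (∀ u ∈ B, φ (FreeGroup.mk u) = 1) ∧
        ∀ l, φ (FreeGroup.mk l) = 1 → ∃ N m, N ≤ F (d * l.length) + l.length + 2 ∧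
          Derives B N m l := by
    intro k φ hφ
    obtain ⟨B, d, hB, hB1, H⟩ := h.exists_derives hΓ φ hφ θ
    refine ⟨B, d, hB, hB1, fun l hl => ?_⟩
    obtain ⟨x, w, hw, hD⟩ := H l hl
    obtain ⟨N, m, hN, hf⟩ := hfill x w
    have := hN.trans (hF hw)
    exact ⟨_, _, by omega, hD _ _ hf⟩
  constructor
  · obtain ⟨n, φ, hφ⟩ : ∃ (n : ℕ) (φ : FreeGroup (Fin n) →* G), Function.Surjective φ := by
      obtain ⟨α, _, φ, hφ⟩ := Group.fg_iff_exists_freeGroup_hom_surjective_finite.1 (h.fg hΓ)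
      exact ⟨_, φ.comp (FreeGroup.freeGroupCongr (Finite.equivFin α).symm).toMonoidHom,
        hφ.comp (MulEquiv.surjective _)⟩
    obtain ⟨B, d, hB, hB1, H⟩ := key n φ hφ
    refine ⟨n, φ, hφ, FreeGroup.mk '' B, hB.image _, le_antisymm ?_ ?_⟩
    · refine Subgroup.normalClosure_le_normal ?_
      rintro _ ⟨u, hu, rfl⟩
      exact hB1 u hu
    · intro w hw
      obtain ⟨l, rfl⟩ := Quot.exists_rep w
      obtain ⟨N, m, -, hD⟩ := H l hw
      -- Derived words die in the quotient by the normal closure of `B`, since the words of `B` do.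
      rw [← QuotientGroup.ker_mk' (Subgroup.normalClosure _)]
      refine hD.map_eq_one _ fun u hu => ?_
      rw [← MonoidHom.mem_ker, QuotientGroup.ker_mk']
      exact Subgroup.subset_normalClosure ⟨u, hu, rfl⟩
  · intro k φ R hφ _ hR
    obtain ⟨B, d, hB, hB1, H⟩ := key k φ hφ
    obtain ⟨A, hA⟩ : ∃ A, ∀ u ∈ B, IsRelatorProduct R A (FreeGroup.mk u) := by
      have : ∀ u ∈ B, ∃ N, IsRelatorProduct R N (FreeGroup.mk u) := fun u hu =>
        IsRelatorProduct.exists_of_mem_normalClosure (hR ▸ hB1 u hu)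
      choose! a ha using this
      obtain ⟨A, hA⟩ := (hB.image a).bddAbove
      exact ⟨A, fun u hu => (ha u hu).mono (hA ⟨u, hu, rfl⟩)⟩
    obtain ⟨f, hf, hfn⟩ := hP A d
    refine ⟨f, hf, fun n => iSup_le fun w => iSup_le fun hw => iSup_le fun hwR => ?_⟩
    rw [hR] at hwR
    obtain ⟨N, m, hN, hD⟩ := H w hwR
    refine (hD.isRelatorProduct hA).relatorArea_le.trans ?_
    have h₁ : F (d * w.length) ≤ F (d * n) := hF (Nat.mul_le_mul_left d hw)
    have h₂ : A * N ≤ A * (F (d * n) + n + 2) := Nat.mul_le_mul_left A (by omega)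
    exact_mod_cast h₂.trans (hfn n)

end Action

theorem IsShortcutGroup.hasIsoperimetricFunction {G : Type u} [Group G]
    (hG : IsShortcutGroup.{u, v} G) : HasIsoperimetricFunction G IsExponential := by
  obtain ⟨V, Γ, _, hΓ, h⟩ := hG
  obtain ⟨θ, hθ⟩ := exists_fills_of_isShortcut hΓ
  refine h.hasIsoperimetricFunction hΓ.1 (θ := θ) (F := fun n => 2 ^ n)
    (fun a b hab => Nat.pow_le_pow_right (by norm_num) hab)
    (fun x w => ?_) fun A d => ?_
  · obtain ⟨N, hN, hf⟩ := hθ θ le_rfl x w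
    exact ⟨N, _, hN, hf⟩
  -- With C this constant, 2^(dn), n and 2 are at most one, one and two times 2^(Cn), which gives
  -- the factor 4A.
  · refine ⟨_, ⟨4 * A + d + 1, fun n => rfl⟩, fun n => ?_⟩
    have h₁ : 2 ^ (d * n) ≤ 2 ^ ((4 * A + d + 1) * n) :=
      Nat.pow_le_pow_right (by norm_num) (Nat.mul_le_mul_right n (by omega))
    have h₂ : n ≤ 2 ^ ((4 * A + d + 1) * n) :=
      Nat.lt_two_pow_self.le.trans (Nat.pow_le_pow_right (by norm_num) (by nlinarith))
    have h₃ : 1 ≤ 2 ^ ((4 * A + d + 1) * n) := Nat.one_le_two_pow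
    calc A * (2 ^ (d * n) + n + 2) ≤ A * (4 * 2 ^ ((4 * A + d + 1) * n)) :=
          Nat.mul_le_mul_left A (by omega)
      _ = 4 * A * 2 ^ ((4 * A + d + 1) * n) := by ring
      _ ≤ _ := Nat.mul_le_mul_right _ (by omega)

theorem IsStronglyShortcutGroup.hasIsoperimetricFunction {G : Type u} [Group G]
    (hG : IsStronglyShortcutGroup.{u, v} G) : HasIsoperimetricFunction G IsPolynomial := by
  obtain ⟨V, Γ, _, hΓ, h⟩ := hG
  obtain ⟨b, hb, θ, hθ⟩ := exists_fills_of_isStronglyShortcut hΓ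
  set e := ⌈Real.logb b 2⌉₊ with he
  -- The base n + 1 is at least 1, so the exponent may be rounded up and the `max 1` is absorbed.
  refine h.hasIsoperimetricFunction hΓ.1 (θ := θ) (F := fun n => (n + 1) ^ e)
    (fun a b hab => Nat.pow_le_pow_left (by omega) e) (fun x w => ?_) fun A d => ?_
  · obtain ⟨N, hN, hf⟩ := hθ θ le_rfl x w
    refine ⟨N, _, ?_, hf⟩
    have h1 : (1 : ℝ) ≤ (w.length : ℝ) + 1 := by
      have : (0 : ℝ) ≤ w.length := by positivity
      linarith
    have : (N : ℝ) ≤ ((w.length : ℝ) + 1) ^ e := by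
      refine hN.trans (max_le (one_le_pow₀ h1) ?_)
      rw [← Real.rpow_natCast]
      exact (Real.rpow_le_rpow (by positivity) (by linarith) (Real.logb_pos hb (by norm_num)).le).trans
        (Real.rpow_le_rpow_of_exponent_le h1 (Nat.le_ceil _))
    exact_mod_cast this
  · refine ⟨_, ⟨.C A * ((.C d * .X + 1) ^ e + .X + 2), fun n => rfl⟩, fun n => ?_⟩
    simp

/-! ### The word problem -/

section WordProblem

variable {k : ℕ}

/-- All ways to cut a list into two. -/
def splits {α : Type*} (l : List α) : List (List α × List α) :=
  (List.range (l.length + 1)).map fun i => (l.take i, l.drop i)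

theorem mem_splits {α : Type*} {l a b : List α} : (a, b) ∈ splits l ↔ a ++ b = l := by
  simp only [splits, List.mem_map, List.mem_range, Prod.mk.injEq]
  constructor
  · rintro ⟨i, _, rfl, rfl⟩
    exact List.take_append_drop i l
  · rintro rfl
    exact ⟨a.length, by simp, by simp⟩

theorem primrec_splits {α : Type*} [Primcodable α] : Primrec (splits (α := α)) :=
  Primrec.list_map (Primrec.list_range.comp (Primrec.succ.comp Primrec.list_length))
    (Primrec.pair (Primrec.list_take.comp Primrec.snd Primrec.fst)
      (Primrec.list_drop.comp Primrec.snd Primrec.fst))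

/-- The words obtained from `u = S Q T` and `v = P Q⁻¹` by replacing `Q` by `P` in `u`. -/
def replacements (u v : List (Fin k × Bool)) : List (List (Fin k × Bool)) :=
  (splits u).flatMap fun a => (splits a.2).flatMap fun b => (splits v).flatMap fun c =>
    if c.2 = FreeGroup.invRev b.1 then [a.1 ++ c.1 ++ b.2] else []

theorem mem_replacements {u v w : List (Fin k × Bool)} :
    w ∈ replacements u v ↔ ∃ S P Q T, u = S ++ Q ++ T ∧ v = P ++ FreeGroup.invRev Q ∧
      w = S ++ P ++ T := by
  simp only [replacements, List.mem_flatMap, Prod.exists, mem_splits]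
  constructor
  · rintro ⟨S, R, rfl, Q, T, rfl, P, Q', rfl, hw⟩
    split_ifs at hw with h
    · subst h
      exact ⟨S, P, Q, T, by simp, rfl, by simpa using hw⟩
    · simp at hw
  · rintro ⟨S, P, Q, T, rfl, rfl, rfl⟩
    exact ⟨S, Q ++ T, by simp, Q, T, rfl, P, FreeGroup.invRev Q, rfl, by simp⟩

theorem primrec_invRev : Primrec (FreeGroup.invRev (α := Fin k)) :=
  Primrec.list_reverse.comp (Primrec.list_map Primrec.id
    ((Primrec.dom_finite fun g : Fin k × Bool => (g.1, !g.2)).comp Primrec.snd))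

theorem primrec_replacements : Primrec₂ (replacements (k := k)) := by
  unfold replacements
  refine Primrec.list_flatMap (primrec_splits.comp Primrec.fst) ?_
  refine Primrec.list_flatMap (primrec_splits.comp (Primrec.snd.comp Primrec.snd)) ?_
  refine Primrec.list_flatMap (primrec_splits.comp (Primrec.snd.comp (Primrec.fst.comp
    Primrec.fst))) ?_
  have ha : Primrec fun z : (((List (Fin k × Bool) × List (Fin k × Bool)) ×
      (List (Fin k × Bool) × List (Fin k × Bool))) ×
      (List (Fin k × Bool) × List (Fin k × Bool))) ×
      (List (Fin k × Bool) × List (Fin k × Bool)) => z.1.1.2.1 :=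
    Primrec.fst.comp (Primrec.snd.comp (Primrec.fst.comp Primrec.fst))
  have hb : Primrec fun z : (((List (Fin k × Bool) × List (Fin k × Bool)) ×
      (List (Fin k × Bool) × List (Fin k × Bool))) ×
      (List (Fin k × Bool) × List (Fin k × Bool))) ×
      (List (Fin k × Bool) × List (Fin k × Bool)) => z.1.2 :=
    Primrec.snd.comp Primrec.fst
  have hc : Primrec fun z : (((List (Fin k × Bool) × List (Fin k × Bool)) ×
      (List (Fin k × Bool) × List (Fin k × Bool))) ×
      (List (Fin k × Bool) × List (Fin k × Bool))) ×
      (List (Fin k × Bool) × List (Fin k × Bool)) => z.2 :=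
    Primrec.snd
  refine Primrec.ite (Primrec.eq.comp (Primrec.snd.comp hc)
    (primrec_invRev.comp (Primrec.fst.comp hb))) ?_ (Primrec.const [])
  exact Primrec.list_cons.comp (Primrec.list_append.comp (Primrec.list_append.comp ha
    (Primrec.fst.comp hc)) (Primrec.snd.comp hb)) (Primrec.const [])

/-- The words with a derivation of depth at most `m` from the words of a list. -/
def derivable (L : List (List (Fin k × Bool))) (m : ℕ) : List (List (Fin k × Bool)) :=
  m.rec L fun _ T => T ++ T.flatMap fun u => T.flatMap fun v => replacements u v

theorem primrec_derivable (L : List (List (Fin k × Bool))) : Primrec (derivable L) := by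
  refine Primrec.nat_rec₁ L ?_
  refine Primrec.list_append.comp Primrec.snd (Primrec.list_flatMap Primrec.snd ?_)
  refine Primrec.list_flatMap (Primrec.snd.comp Primrec.fst) ?_
  exact primrec_replacements.comp (Primrec.snd.comp Primrec.fst) Primrec.snd

theorem mem_derivable_succ {L : List (List (Fin k × Bool))} {m : ℕ} {w : List (Fin k × Bool)} :
    w ∈ derivable L (m + 1) ↔
      w ∈ derivable L m ∨ ∃ u ∈ derivable L m, ∃ v ∈ derivable L m, w ∈ replacements u v := by
  change w ∈ derivable L m ++ _ ↔ _
  simp only [List.mem_append, List.mem_flatMap]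
  rfl

theorem Derives.mem_derivable {L : List (List (Fin k × Bool))} {N m : ℕ}
    {w : List (Fin k × Bool)} (h : Derives {u | u ∈ L} N m w) : w ∈ derivable L m := by
  induction h with
  | @base m u hu =>
    -- Each stage keeps the previous list, so a word of `L` is found at every depth.
    induction m with
    | zero => exact hu
    | succ m ih => exact mem_derivable_succ.2 (.inl ih)
  | replace S P Q T _ _ ih₁ ih₂ =>
    exact mem_derivable_succ.2
      (.inr ⟨_, ih₁, _, ih₂, mem_replacements.2 ⟨S, P, Q, T, rfl, rfl, rfl⟩⟩)

theorem map_eq_one_of_mem_derivable {G : Type*} [Group G] (φ : FreeGroup (Fin k) →* G)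
    {L : List (List (Fin k × Bool))} (hL : ∀ u ∈ L, φ (FreeGroup.mk u) = 1) {m : ℕ} :
    ∀ w ∈ derivable L m, φ (FreeGroup.mk w) = 1 := by
  induction m with
  | zero => exact hL
  | succ m ih =>
    intro w hw
    rcases mem_derivable_succ.1 hw with hw | ⟨u, hu, v, hv, hw⟩
    · exact ih w hw
    · obtain ⟨S, P, Q, T, rfl, rfl, rfl⟩ := mem_replacements.1 hw
      have h₁ := ih _ hu
      have h₂ := ih _ hv
      simp only [← FreeGroup.mul_mk, ← FreeGroup.inv_mk, map_mul, map_inv] at h₁ h₂ ⊢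
      rw [mul_inv_eq_one.1 h₂]
      exact h₁

/-- The algorithm looks for `l` in the finite list of words derivable to depth `f l.length`: listed
words are trivial in G, and the depth bound ensures that every trivial word is listed. The list `L`
is a fixed constant of the algorithm. -/
theorem computablePred_of_derives {G : Type*} [Group G] (φ : FreeGroup (Fin k) →* G)
    {B : Set (List (Fin k × Bool))} (hB : B.Finite) (hB1 : ∀ u ∈ B, φ (FreeGroup.mk u) = 1)
    {f : ℕ → ℕ} (hf : Primrec f)
    (h : ∀ l, φ (FreeGroup.mk l) = 1 → ∃ N, Derives B N (f l.length) l) :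
    ComputablePred fun l : List (Fin k × Bool) => φ (FreeGroup.mk l) = 1 := by
  obtain ⟨L, rfl⟩ : ∃ L : List (List (Fin k × Bool)), B = {u | u ∈ L} :=
    ⟨hB.toFinset.toList, by ext; simp⟩
  have hiff : ∀ l : List (Fin k × Bool),
      (∃ u ∈ derivable L (f l.length), u = l) ↔ φ (FreeGroup.mk l) = 1 := by
    intro l
    simp only [exists_eq_right]
    refine ⟨map_eq_one_of_mem_derivable φ hB1 l, fun hl => ?_⟩
    obtain ⟨N, hN⟩ := h l hl
    exact hN.mem_derivable
  have hp : PrimrecPred fun l : List (Fin k × Bool) => ∃ u ∈ derivable L (f l.length), u = l :=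
    (PrimrecRel.exists_mem_list Primrec.eq).comp
      ((primrec_derivable L).comp (hf.comp Primrec.list_length)) Primrec.id
  obtain ⟨_, hp⟩ := hp
  refine ComputablePred.of_eq ⟨inferInstance, hp.to_comp⟩ hiff

end WordProblem

theorem IsShortcutGroup.hasDecidableWordProblem {G : Type u} [Group G]
    (hG : IsShortcutGroup.{u, v} G) : HasDecidableWordProblem G := by
  obtain ⟨V, Γ, _, hΓ, h⟩ := hG
  obtain ⟨θ, hθ⟩ := exists_fills_of_isShortcut hΓ
  refine ⟨h.fg hΓ.1, fun k s hs => ?_⟩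
  have hsurj : Function.Surjective (FreeGroup.lift s) := by
    rwa [FreeGroup.lift_surjective_iff_closure_range_eq_top]
  obtain ⟨B, d, hB, hB1, H⟩ := h.exists_derives hΓ.1 (FreeGroup.lift s) hsurj θ
  -- The walk has length at most d * n, which bounds its cutting depth; `exists_derives` adds n + 2.
  refine computablePred_of_derives (FreeGroup.lift s) hB hB1 (f := fun n => d * n + n + 2)
    (Primrec.nat_add.comp (Primrec.nat_add.comp (Primrec.nat_mul.comp (Primrec.const d) Primrec.id)
      Primrec.id) (Primrec.const 2)) fun l hl => ?_
  obtain ⟨x, w, hw, hD⟩ := H l hl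
  obtain ⟨N, -, hf⟩ := hθ θ le_rfl x w
  exact ⟨_, hD N _ (hf.mono hw)⟩

end ShortcutGraph

theorem mainTheorem2 :
    -- graphs
    (∀ {V : Type u} (Γ : SimpleGraph V), ShortcutGraph.IsShortcut Γ →
      ∃ θ₀ : ℕ, ∀ θ ≥ θ₀, ∀ n : ℕ,
        (ShortcutGraph.filling Γ θ).dehn n ≤ ((2 ^ n : ℕ) : ℕ∞)) ∧
    (∀ {V : Type u} (Γ : SimpleGraph V), ShortcutGraph.IsStronglyShortcut Γ →
      ∃ b : ℝ, 1 < b ∧ ∃ θ₀ : ℕ, ∀ θ ≥ θ₀, ∀ n : ℕ,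
        (((ShortcutGraph.filling Γ θ).dehn n : ℕ∞) : ℝ≥0∞) ≤
          ENNReal.ofReal ((n : ℝ) ^ Real.logb b 2)) ∧
    -- groups
    (∀ (G : Type u) [Group G], ShortcutGraph.IsShortcutGroup.{u, v} G →
      ShortcutGraph.HasIsoperimetricFunction G ShortcutGraph.IsExponential) ∧
    (∀ (G : Type u) [Group G], ShortcutGraph.IsStronglyShortcutGroup.{u, v} G →
      ShortcutGraph.HasIsoperimetricFunction G ShortcutGraph.IsPolynomial) ∧
    (∀ (G : Type u) [Group G], ShortcutGraph.IsShortcutGroup.{u, v} G →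
      ShortcutGraph.HasDecidableWordProblem G) :=
  ⟨fun _ hΓ => ShortcutGraph.dehn_filling_le_of_isShortcut hΓ,
    fun _ hΓ => ShortcutGraph.dehn_filling_le_of_isStronglyShortcut hΓ,
    fun _ _ hG => hG.hasIsoperimetricFunction,
    fun _ _ hG => hG.hasIsoperimetricFunction,
    fun _ _ hG => hG.hasDecidableWordProblem⟩
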